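/- Let $G_2,G_4,G_6,\ldots = 1,1,3,17,155,2073,\ldots$ be the Genocchi numbers, defined by $$\frac{2t}{e^t+1}=t+\sum_{m\ge 1}(-1)^m G_{2m}\frac{t^{2m}}{(2m)!}.$$ Let $\mathcal S_k$ be the set of permutations $\sigma=\sigma_1\cdots\sigma_k$ of $\{1,\ldots,k\}$. A pair of adjacent letters $\sigma_i\sigma_{i+1}$ is an occurrence of the pattern $2^*1^e$ if $\sigma_i>\sigma_{i+1}$ and $\sigma_{i+1}$ is even; of $2^e1^*$ if $\sigma_i>\sigma_{i+1}$ and $\sigma_i$ is even; of $2^o1^*$ if $\sigma_i>\sigma_{i+1}$ and $\sigma_i$ is odd; of $1^e2^*$ if $\sigma_i<\sigma_{i+1}$ and $\sigma_i$ is even. A permutation avoids a pattern if it has no occurrence of it. **Theorem.** Let $n\ge 1$. 1. If the number of permutations in $\mathcal S_{2n}$ that avoid both $2^*1^e$ and $2^e1^*$ is $G_{2n+2}$ (this is the case $n$ of the Conjecture that this holds for all $n\ge1$), then the number of permutations in $\mathcal S_{2n-1}$ that avoid both $2^*1^e$ and $2^e1^*$ is also $G_{2n+2}$. In particular, the Conjecture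 implies this count for every $n\ge 1$. 2. Unconditionally, the number of permutations in $\mathcal S_{2n}$ that avoid both $1^e2^*$ and $2^o1^*$ is $2G_{2n+2}$. -/

import Mathlib

/-- The superscript of a letter of a pattern: `e` (even), `o` (odd) or `*` (either). -/
inductive ParityMark where
  | e : ParityMark
  | o : ParityMark
  | star : ParityMark

/-- `m.Allows v` says that the number `v` has the parity prescribed by the superscript `m`. -/
def ParityMark.Allows : ParityMark → ℕ → Prop
  | .e, v => Even v
  | .o, v => Odd v
  | .star, _ => True

/-- A consecutive pattern (without dashes) with `k` letters, each carrying a parity superscript. -/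
structure ParityPattern (k : ℕ) where
  letter : Fin k → ℕ
  mark : Fin k → ParityMark

/-- The word `σ_1 σ_2 ⋯ σ_n` of a permutation of `{1, …, n}`: the permutation is an element of
`Equiv.Perm (Fin n)`, positions are counted from `0`, and `Fin n` is identified with
`{1, …, n}` by adding `1`. -/
def permLetter {n : ℕ} (σ : Equiv.Perm (Fin n)) (i : Fin n) : ℕ := (σ i : ℕ) + 1

/-- The `k` consecutive letters of `σ` starting at position `i` (counted from `0`) form an
occurrence of `p`: they are in the same relative order as the letters of `p` and they have the
prescribed parities. -/
def ParityPattern.OccursAt {k n : ℕ} (p : ParityPattern k) (σ : Equiv.Perm (Fin n)) (i : ℕ) :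
    Prop :=
  ∃ h : i + k ≤ n,
    (∀ a b : Fin k, p.letter a < p.letter b ↔
      permLetter σ ⟨i + a, by omega⟩ < permLetter σ ⟨i + b, by omega⟩) ∧
    ∀ a : Fin k, (p.mark a).Allows (permLetter σ ⟨i + a, by omega⟩)

/-- `σ` avoids `p`: it has no occurrence of `p`. -/
def ParityPattern.AvoidedBy {k n : ℕ} (p : ParityPattern k) (σ : Equiv.Perm (Fin n)) : Prop :=
  ∀ i : ℕ, ¬ p.OccursAt σ i

/-- The number of permutations of `{1, …, n}` that avoid both `p` and `q`. -/
noncomputable def avoidCount {k l : ℕ} (n : ℕ) (p : ParityPattern k) (q : ParityPattern l) : ℕ :=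
  Nat.card {σ : Equiv.Perm (Fin n) // p.AvoidedBy σ ∧ q.AvoidedBy σ}

/-- The pattern `2^* 1^e`: a descent ending with an even number. -/
def pattern2s1e : ParityPattern 2 := ⟨![2, 1], ![.star, .e]⟩

/-- The pattern `2^e 1^*`: a descent beginning with an even number. -/
def pattern2e1s : ParityPattern 2 := ⟨![2, 1], ![.e, .star]⟩

/-- The pattern `2^o 1^*`: a descent beginning with an odd number. -/
def pattern2o1s : ParityPattern 2 := ⟨![2, 1], ![.o, .star]⟩

/-- The pattern `1^e 2^*`: an ascent beginning with an even number. -/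
def pattern1e2s : ParityPattern 2 := ⟨![1, 2], ![.e, .star]⟩

/-- The formal power series `2t / (e^t + 1)` over `ℚ`. -/
noncomputable def genocchiSeries : PowerSeries ℚ :=
  2 * PowerSeries.X * (PowerSeries.exp ℚ + 1)⁻¹

/-- `genocchi m` is the Genocchi number `G_{2m}`, given by
`2t / (e^t + 1) = t + ∑_{m ≥ 1} (-1)^m G_{2m} t^{2m} / (2m)!`. -/
noncomputable def genocchi (m : ℕ) : ℚ :=
  (-1) ^ m * ((2 * m).factorial : ℚ) * PowerSeries.coeff (2 * m) genocchiSeries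

/-! ### Weighted words and insertion of a largest letter -/

/-- The sum `g e` over a word with `e` non-final odd letters followed by a smaller letter, provided
that every even letter is followed by a smaller one (so the last letter is odd); otherwise `0`. -/
def altWeight : (ℕ → ℚ) → List ℕ → ℚ
  | _, [] => 0
  | g, [a] => if Even a then 0 else g 0
  | g, a :: b :: t =>
    if Even a then (if b < a then altWeight g (b :: t) else 0)
    else if a < b then altWeight g (b :: t) else altWeight (fun e => g (e + 1)) (b :: t)

/-- The number of odd letters. -/
def oddCount (w : List ℕ) : ℕ := w.countP (fun a => ¬ Even a)

theorem oddCount_cons (a : ℕ) (w : List ℕ) :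
    oddCount (a :: w) = oddCount w + if Even a then 0 else 1 := by
  unfold oddCount
  rw [List.countP_cons]
  by_cases h : Even a <;> simp [h]

theorem altWeight_add (g h : ℕ → ℚ) (w : List ℕ) :
    altWeight (fun e => g e + h e) w = altWeight g w + altWeight h w := by
  induction w generalizing g h with
  | nil => simp [altWeight]
  | cons a t ih =>
    cases t with
    | nil => simp only [altWeight]; split_ifs <;> simp
    | cons b t =>
      simp only [altWeight]
      split_ifs
      · exact ih g h
      · simp
      · exact ih g h
      · exact ih (fun e => g (e + 1)) (fun e => h (e + 1))

theorem altWeight_const_mul (c : ℚ) (g : ℕ → ℚ) (w : List ℕ) :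
    altWeight (fun e => c * g e) w = c * altWeight g w := by
  induction w generalizing g with
  | nil => simp [altWeight]
  | cons a t ih =>
    cases t with
    | nil => simp only [altWeight]; split_ifs <;> simp
    | cons b t =>
      simp only [altWeight]
      split_ifs
      · exact ih g
      · simp
      · exact ih g
      · exact ih (fun e => g (e + 1))

/-- A nonzero value needs an odd last letter, which is never bad; so e stays below the number of odd
letters. -/
theorem altWeight_congr {g h : ℕ → ℚ} {w : List ℕ}
    (H : ∀ e, e < oddCount w → g e = h e) : altWeight g w = altWeight h w := by
  induction w generalizing g h with
  | nil => simp [altWeight]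
  | cons a t ih =>
    rw [oddCount_cons] at H
    cases t with
    | nil =>
      simp only [altWeight]
      split_ifs with h1
      · rfl
      · exact H 0 (by simp [h1])
    | cons b t =>
      simp only [altWeight]
      split_ifs with h1 h2 h2
      · exact ih fun e he => H e (by omega)
      · rfl
      · exact ih fun e he => H e (by omega)
      · exact ih fun e he => H (e + 1) (by rw [if_neg h1]; omega)

/-- Weighted insertions of a larger odd letter behind the first letter. -/
theorem sum_insert_odd_tail {v : ℕ} (hv : ¬ Even v) (g : ℕ → ℚ) (a : ℕ) (t : List ℕ)
    (hlt : ∀ b ∈ a :: t, b < v) :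
    ((t.permutations'Aux v).map fun u => altWeight g (a :: u)).sum =
      altWeight (fun e => (e + 1) * g e + (oddCount (a :: t) - 1 - e) * g (e + 1)) (a :: t) := by
  induction t generalizing a g with
  | nil =>
    have := hlt a (by simp)
    by_cases h : Even a
    · simp [altWeight, h, this.le]
    · simp [altWeight, h, hv, this, oddCount, -Nat.not_even_iff_odd]
  | cons b t ih =>
    have ha := hlt a (by simp)
    have hb := hlt b (by simp)
    have ih' := fun g => ih g b fun c hc => hlt c (List.mem_cons_of_mem _ hc)
    rw [List.permutations'Aux, List.map_cons, List.sum_cons, List.map_map]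
    simp only [Function.comp_def]
    rw [oddCount_cons a]
    simp only [altWeight, hv, hb.not_gt, if_false]
    by_cases h : Even a
    · simp only [h, if_true, ha.not_gt, if_false, zero_add, add_zero]
      split_ifs with h2
      · rw [ih']
      · simp
    · simp only [h, if_false, ha, if_true]
      split_ifs with h2
      · rw [ih', ← altWeight_add]
        congr 1; ext e; push_cast; ring
      · rw [ih', ← altWeight_add]
        congr 1; ext e; push_cast; ring

/-- Weighted insertions of a larger even letter behind the first letter. -/
theorem sum_insert_even_tail {v : ℕ} (hv : Even v) (g : ℕ → ℚ) (a : ℕ) (t : List ℕ)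
    (hlt : ∀ b ∈ a :: t, b < v) :
    ((t.permutations'Aux v).map fun u => altWeight g (a :: u)).sum =
      altWeight (fun e => (oddCount (a :: t) - 1 - e) * g e + e * g (e - 1)) (a :: t) := by
  induction t generalizing a g with
  | nil =>
    have := hlt a (by simp)
    by_cases h : Even a
    · simp [altWeight, h, this.le]
    · simp [altWeight, h, hv, this, oddCount, -Nat.not_even_iff_odd]
  | cons b t ih =>
    have ha := hlt a (by simp)
    have hb := hlt b (by simp)
    have ih' := fun g => ih g b fun c hc => hlt c (List.mem_cons_of_mem _ hc)
    rw [List.permutations'Aux, List.map_cons, List.sum_cons, List.map_map]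
    simp only [Function.comp_def]
    rw [oddCount_cons a]
    simp only [altWeight, hv, hb, if_true]
    by_cases h : Even a
    · simp only [h, if_true, ha.not_gt, if_false, zero_add, add_zero]
      split_ifs with h2
      · rw [ih']
      · simp
    · simp only [h, if_false, ha, if_true]
      split_ifs with h2
      · rw [ih', ← altWeight_add]
        congr 1; ext e; push_cast; ring
      · rw [ih', ← altWeight_add]
        congr 1; ext e
        -- The truncated `e - 1` at `e = 0` is harmless: its factor `e` vanishes.
        rcases e with _ | e
        · push_cast; ring
        · push_cast [Nat.add_sub_cancel]; ring

/-- The new letter is bad unless last, and must not follow an even letter. The gaps after the e bad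
letters and the end keep e; the front and the gaps after good non-final odd letters raise it by one.
-/
theorem sum_insert_odd {v : ℕ} (hv : ¬ Even v) (g : ℕ → ℚ) {w : List ℕ} (hw : w ≠ [])
    (hlt : ∀ b ∈ w, b < v) :
    ((w.permutations'Aux v).map (altWeight g)).sum =
      altWeight (fun e => (e + 1) * g e + (oddCount w - e) * g (e + 1)) w := by
  obtain ⟨a, t, rfl⟩ := List.exists_cons_of_ne_nil hw
  rw [List.permutations'Aux, List.map_cons, List.sum_cons, List.map_map]
  simp only [Function.comp_def]
  rw [sum_insert_odd_tail hv g a t hlt, altWeight, if_neg hv, if_neg (hlt a (by simp)).not_gt,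
    ← altWeight_add]
  congr 1; ext e; ring

/-- The new letter cannot be last or follow an even letter. Placed after a bad letter it repairs it;
at the front or after a good non-final odd letter it leaves e unchanged. -/
theorem sum_insert_even {v : ℕ} (hv : Even v) (g : ℕ → ℚ) {w : List ℕ} (hw : w ≠ [])
    (hlt : ∀ b ∈ w, b < v) :
    ((w.permutations'Aux v).map (altWeight g)).sum =
      altWeight (fun e => (oddCount w - e) * g e + e * g (e - 1)) w := by
  obtain ⟨a, t, rfl⟩ := List.exists_cons_of_ne_nil hw
  rw [List.permutations'Aux, List.map_cons, List.sum_cons, List.map_map]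
  simp only [Function.comp_def]
  rw [sum_insert_even_tail hv g a t hlt, altWeight, if_pos hv, if_pos (hlt a (by simp)),
    ← altWeight_add]
  congr 1; ext e; ring

/-! ### The counting polynomials and their recurrences -/

/-- The list `[m, …, 2, 1]`. -/
def descList : ℕ → List ℕ
  | 0 => []
  | m + 1 => (m + 1) :: descList m

theorem mem_descList {m a : ℕ} : a ∈ descList m ↔ 1 ≤ a ∧ a ≤ m := by
  induction m with
  | zero => simp [descList]; omega
  | succ m ih => rw [descList, List.mem_cons, ih]; omega

theorem nodup_descList (m : ℕ) : (descList m).Nodup := by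
  induction m with
  | zero => simp [descList]
  | succ m ih => rw [descList, List.nodup_cons, mem_descList]; exact ⟨by omega, ih⟩

theorem length_descList (m : ℕ) : (descList m).length = m := by
  induction m with
  | zero => rfl
  | succ m ih => rw [descList, List.length_cons, ih]

theorem oddCount_descList (m : ℕ) : oddCount (descList m) = (m + 1) / 2 := by
  induction m with
  | zero => rfl
  | succ m ih =>
    rw [descList, oddCount_cons, ih]
    split_ifs with h <;> rw [Nat.even_iff] at h <;> omega

/-- The generalized binomial coefficient `z.choose p`. -/
def ratChoose : ℕ → ℚ → ℚ
  | 0, _ => 1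
  | p + 1, z => ratChoose p z * (z - p) / (p + 1)

theorem ratChoose_succ (p : ℕ) (z : ℚ) :
    ratChoose (p + 1) z = ratChoose p z * (z - p) / (p + 1) := rfl

theorem ratChoose_succ_add_one (p : ℕ) (z : ℚ) :
    ratChoose (p + 1) (z + 1) = ratChoose p z * (z + 1) / (p + 1) := by
  induction p with
  | zero => simp [ratChoose]
  | succ p ih =>
    rw [ratChoose, ih, ratChoose]
    push_cast
    have : (p : ℚ) + 1 ≠ 0 := by positivity
    have : (p : ℚ) + 1 + 1 ≠ 0 := by positivity
    field_simp
    ring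

theorem ratChoose_self (p : ℕ) : ratChoose p p = 1 := by
  induction p with
  | zero => rfl
  | succ p ih =>
    push_cast
    rw [ratChoose_succ_add_one, ih, one_mul, div_self (by positivity)]

theorem ratChoose_eq_zero {p m : ℕ} (h : m < p) : ratChoose p m = 0 := by
  induction p with
  | zero => omega
  | succ p ih =>
    rw [ratChoose]
    rcases Nat.lt_succ_iff_lt_or_eq.1 h with h | rfl
    · simp [ih h]
    · simp

/-- The weighted count of words on `{1, …, m}`. -/
def altSum (m : ℕ) (x : ℚ) : ℚ :=
  ((descList m).permutations'.map
    (altWeight fun e => ratChoose ((m + 1) / 2) (x + ((m + 1) / 2 : ℕ) - 1 - e))).sum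

theorem altSum_one (x : ℚ) : altSum 1 x = x := by
  simp [altSum, descList, altWeight, ratChoose]

theorem sum_map_permutations'_descList_succ (f : List ℕ → ℚ) (m : ℕ) :
    ((descList (m + 1)).permutations'.map f).sum =
      ((descList m).permutations'.map fun w => ((w.permutations'Aux (m + 1)).map f).sum).sum := by
  rw [descList, List.permutations', List.map_flatMap, List.flatMap_def,
    List.sum_flatten, List.map_map]
  rfl

/-- With p = n+1 and y = x+p-1-e this is (e+1) binom(y+1, p+1) + (p-e) binom(y, p+1) = x binom(y,
p). -/
theorem altSum_odd (n : ℕ) (x : ℚ) : altSum (2 * n + 3) x = x * altSum (2 * n + 2) x := by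
  unfold altSum
  rw [sum_map_permutations'_descList_succ, ← List.sum_map_mul_left]
  congr 1
  apply List.map_congr_left
  intro w hw
  rw [List.mem_permutations'] at hw
  rw [sum_insert_odd (by rw [Nat.even_iff]; omega), ← altWeight_const_mul]
  · have hp : oddCount w = n + 1 := by
      rw [oddCount, hw.countP_eq, ← oddCount, oddCount_descList]; omega
    rw [hp, show (2 * n + 2 + 1) / 2 = n + 1 by omega, show (2 * n + 3 + 1) / 2 = n + 1 + 1 by omega]
    congr 1; ext e
    have h1 : x + ((n + 1 + 1 : ℕ) : ℚ) - 1 - e = (x + ((n + 1 : ℕ) : ℚ) - 1 - e) + 1 := by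
      push_cast; ring
    have h2 : x + ((n + 1 + 1 : ℕ) : ℚ) - 1 - ((e + 1 : ℕ) : ℚ) = x + ((n + 1 : ℕ) : ℚ) - 1 - e := by
      push_cast; ring
    rw [h1, h2, ratChoose_succ_add_one, ratChoose_succ (n + 1)]
    push_cast
    have : (n : ℚ) + 1 + 1 ≠ 0 := by positivity
    field_simp
    ring
  · rintro rfl
    simpa [descList] using hw.length_eq
  · intro b hb
    have := mem_descList.1 (hw.mem_iff.1 hb)
    omega

/-- With p = n+1 and y = x+p-1-e this amounts to (y+1) binom(y, p) = (y+1-p) binom(y+1, p). -/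
theorem altSum_even (n : ℕ) (x : ℚ) :
    altSum (2 * n + 2) x = x * (altSum (2 * n + 1) (x + 1) - altSum (2 * n + 1) x) := by
  unfold altSum
  rw [sum_map_permutations'_descList_succ, eq_comm, mul_sub, sub_eq_iff_eq_add,
    ← List.sum_map_mul_left, ← List.sum_map_mul_left, ← List.sum_map_add, eq_comm]
  congr 1
  apply List.map_congr_left
  intro w hw
  rw [List.mem_permutations'] at hw
  rw [sum_insert_even (by rw [Nat.even_iff]; omega), ← altWeight_const_mul, ← altWeight_const_mul,
    ← altWeight_add]
  · have hp : oddCount w = n + 1 := by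
      rw [oddCount, hw.countP_eq, ← oddCount, oddCount_descList]; omega
    rw [hp, show (2 * n + 1 + 1) / 2 = n + 1 by omega, show (2 * n + 2 + 1) / 2 = n + 1 by omega]
    congr 1; ext e
    have h1 : (e : ℚ) * ratChoose (n + 1) (x + ((n + 1 : ℕ) : ℚ) - 1 - ((e - 1 : ℕ) : ℚ)) =
        e * ratChoose (n + 1) ((x + ((n + 1 : ℕ) : ℚ) - 1 - e) + 1) := by
      rcases e with _ | e
      · simp
      · congr 2; push_cast [Nat.add_sub_cancel]; ring
    have h2 : x + 1 + ((n + 1 : ℕ) : ℚ) - 1 - e = (x + ((n + 1 : ℕ) : ℚ) - 1 - e) + 1 := by ring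
    rw [h1, h2, ratChoose_succ_add_one, ratChoose_succ n]
    push_cast
    have : (n : ℚ) + 1 ≠ 0 := by positivity
    field_simp
    ring
  · rintro rfl
    simpa [descList] using hw.length_eq
  · intro b hb
    have := mem_descList.1 (hw.mem_iff.1 hb)
    omega

/-- Even letters are followed by smaller letters and odd letters by larger letters. -/
def altRel (a b : ℕ) : Prop := if Even a then b < a else a < b

/-- Every even letter is followed by a smaller one and every odd letter is last or followed by a
larger one. -/
def IsDumont : List ℕ → Prop
  | [] => False
  | [a] => ¬ Even a
  | a :: b :: t => altRel a b ∧ IsDumont (b :: t)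

open Classical in
theorem altWeight_single (w : List ℕ) :
    altWeight (fun e => if e = 0 then 1 else 0) w = if IsDumont w then 1 else 0 := by
  induction w with
  | nil => simp [altWeight, IsDumont]
  | cons a t ih =>
    cases t with
    | nil => by_cases h : Even a <;> simp [altWeight, IsDumont, h]
    | cons b t =>
      have h0 : altWeight (fun _ => 0) (b :: t) = 0 := by
        simpa using altWeight_const_mul 0 (fun _ => 0) (b :: t)
      simp only [altWeight, IsDumont, altRel, ih, Nat.add_eq_zero_iff, one_ne_zero, and_false,
        if_false, h0]
      by_cases h : Even a
      · by_cases h2 : b < a <;> simp [h, h2]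
      · by_cases h2 : a < b <;> simp [h, h2]

-- At x = 1 the weight is binom(p-e, p), which is 1 for e = 0 and 0 for 0 < e < p.
open Classical in
theorem altSum_eq_countP (m : ℕ) :
    altSum m 1 = (descList m).permutations'.countP (fun w => IsDumont w) := by
  have : ∀ l : List (List ℕ), ((l.map fun w => if IsDumont w then (1 : ℚ) else 0).sum) =
      l.countP (fun w => IsDumont w) := by
    intro l
    induction l with
    | nil => simp
    | cons a l ih =>
      rw [List.map_cons, List.sum_cons, ih, List.countP_cons]
      by_cases h : IsDumont a <;> simp [h, add_comm]
  rw [← this, altSum]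
  congr 1
  apply List.map_congr_left
  intro w hw
  rw [List.mem_permutations'] at hw
  rw [← altWeight_single]
  apply altWeight_congr
  intro e he
  rw [oddCount, hw.countP_eq, ← oddCount, oddCount_descList] at he
  have h1 : (1 : ℚ) + ((m + 1) / 2 : ℕ) - 1 - e = (((m + 1) / 2 - e : ℕ) : ℚ) := by
    rw [Nat.cast_sub he.le]; ring
  rw [h1]
  split_ifs with h
  · subst h; exact ratChoose_self _
  · exact ratChoose_eq_zero (by omega)

/-! ### Expansion of t tanh(t/2) in powers of 4 sinh²(t/2) -/

open PowerSeries in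
/-- The series `exp t + exp (-t) - 2`, the square of `2 sinh (t / 2)`. -/
noncomputable def sinhSq : PowerSeries ℚ := exp ℚ + evalNegHom (exp ℚ) - 2

open PowerSeries in
theorem derivative_evalNegHom_exp :
    d⁄dX ℚ (evalNegHom (exp ℚ)) = -evalNegHom (exp ℚ) := by
  ext n
  rw [coeff_derivative, map_neg]
  simp only [evalNegHom, coeff_rescale, coeff_exp, Nat.factorial_succ, pow_succ]
  have := Nat.factorial_ne_zero n
  have : (n : ℚ) + 1 ≠ 0 := by positivity
  push_cast
  simp
  field_simp

open PowerSeries in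
theorem derivative_sinhSq : d⁄dX ℚ sinhSq = exp ℚ - evalNegHom (exp ℚ) := by
  have : d⁄dX ℚ (2 : ℚ⟦X⟧) = 0 := derivative_C (R := ℚ) (r := 2)
  rw [sinhSq, map_sub, map_add, derivative_exp, derivative_evalNegHom_exp, this]
  ring

open PowerSeries in
theorem derivative_derivative_sinhSq : d⁄dX ℚ (d⁄dX ℚ sinhSq) = sinhSq + 2 := by
  rw [derivative_sinhSq, map_sub, derivative_exp, derivative_evalNegHom_exp, sinhSq]
  ring

open PowerSeries in
theorem derivative_sinhSq_sq : d⁄dX ℚ sinhSq ^ 2 = sinhSq ^ 2 + 4 * sinhSq := by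
  rw [derivative_sinhSq, sinhSq]
  linear_combination (-4) * exp_mul_exp_neg_eq_one (A := ℚ)

open PowerSeries in
theorem derivative_derivative_sinhSq_pow (k : ℕ) :
    d⁄dX ℚ (d⁄dX ℚ (sinhSq ^ (k + 1))) =
      ((k : ℚ⟦X⟧) + 1) ^ 2 * sinhSq ^ (k + 1) +
        (2 * k + 2) * (2 * k + 1) * sinhSq ^ k := by
  have hc : ∀ m : ℕ, d⁄dX ℚ (m : ℚ⟦X⟧) = 0 := fun m => by
    have := derivative_C (R := ℚ) (r := (m : ℚ))
    rwa [map_natCast] at this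
  rw [derivative_pow, Derivation.leibniz, Derivation.leibniz, derivative_derivative_sinhSq,
    derivative_pow, hc]
  simp only [smul_eq_mul, Nat.add_sub_cancel]
  rcases k with _ | k
  · simp
  · simp only [Nat.add_sub_cancel]
    push_cast
    linear_combination (((k : ℚ⟦X⟧) + 2) * (k + 1)) * sinhSq ^ k * derivative_sinhSq_sq

open PowerSeries in
theorem coeff_zero_sinhSq : coeff 0 sinhSq = 0 := by
  have : coeff 0 (2 : ℚ⟦X⟧) = 2 := by rw [← map_ofNat C 2, coeff_zero_C]
  rw [sinhSq, map_sub, map_add, this, evalNegHom, coeff_rescale]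
  norm_num [coeff_exp]

open PowerSeries in
theorem X_sq_dvd_sinhSq : (X : ℚ⟦X⟧) ^ 2 ∣ sinhSq := by
  rw [X_pow_dvd_iff]
  intro m hm
  have h1 : coeff 1 sinhSq = 0 := by
    have : coeff 0 (d⁄dX ℚ sinhSq) = 0 := by
      rw [derivative_sinhSq, map_sub, evalNegHom, coeff_rescale]; simp
    rw [coeff_derivative] at this
    simpa using this
  interval_cases m
  · exact coeff_zero_sinhSq
  · exact h1

open PowerSeries in
theorem exists_derivative_sinhSq : ∃ u : ℚ⟦X⟧, d⁄dX ℚ sinhSq = X * u ∧ constantCoeff u = 2 := by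
  have h0 : coeff 0 (d⁄dX ℚ sinhSq) = 0 := by
    rw [derivative_sinhSq, map_sub, evalNegHom, coeff_rescale]; simp
  rw [coeff_zero_eq_constantCoeff_apply] at h0
  obtain ⟨u, hu⟩ := X_dvd_iff.2 h0
  refine ⟨u, hu, ?_⟩
  have h1 : coeff 1 (d⁄dX ℚ sinhSq) = 2 := by
    rw [derivative_sinhSq, map_sub, evalNegHom, coeff_rescale]; norm_num [coeff_exp]
  rw [hu, show (1 : ℕ) = 0 + 1 from rfl, coeff_succ_X_mul] at h1
  simpa using h1

open PowerSeries in
/-- The series `t * tanh (t / 2)`. -/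
noncomputable def genocchiTanh : PowerSeries ℚ := X - genocchiSeries

open PowerSeries in
theorem genocchiTanh_mul : genocchiTanh * (exp ℚ + 1) = X * (exp ℚ - 1) := by
  have h : (exp ℚ + 1)⁻¹ * (exp ℚ + 1) = 1 :=
    PowerSeries.inv_mul_cancel _ (by simp)
  rw [genocchiTanh, genocchiSeries]
  linear_combination (-2 * X) * h

open PowerSeries in
theorem exp_add_one_ne_zero : exp ℚ + 1 ≠ 0 := by
  intro h
  have := congrArg constantCoeff h
  simp at this

-- This linear equation characterizes t tanh(t/2) among series of order at least two, so the
-- expansion can be checked on it alone.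
open PowerSeries in
theorem derivative_sinhSq_mul_derivative_genocchiTanh :
    d⁄dX ℚ sinhSq * d⁄dX ℚ genocchiTanh = sinhSq + 2 * genocchiTanh := by
  have h1 := congrArg (d⁄dX ℚ) genocchiTanh_mul
  simp only [Derivation.leibniz, map_add, map_sub, derivative_exp, derivative_one, smul_eq_mul,
    derivative_X, add_zero, sub_zero, mul_one] at h1
  have h2 := exp_mul_exp_neg_eq_one (A := ℚ)
  have h3 := genocchiTanh_mul
  apply mul_left_cancel₀ exp_add_one_ne_zero
  rw [derivative_sinhSq, sinhSq]
  set e := exp ℚ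
  set e' := evalNegHom e
  set F := genocchiTanh
  set F' := d⁄dX ℚ F
  linear_combination (e - e') * h1 - (e + 1) * h3 + (F - X - 2) * h2

open PowerSeries in
theorem X_sq_dvd_genocchiTanh : (X : ℚ⟦X⟧) ^ 2 ∣ genocchiTanh := by
  have h : X ^ 2 ∣ genocchiTanh * (exp ℚ + 1) := by
    rw [genocchiTanh_mul, pow_two]
    apply mul_dvd_mul_left
    rw [X_dvd_iff]; simp
  have h2 : (exp ℚ + 1)⁻¹ * (exp ℚ + 1) = 1 :=
    PowerSeries.inv_mul_cancel _ (by simp)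
  have := h.mul_right ((exp ℚ + 1)⁻¹)
  rwa [mul_assoc, mul_comm (exp ℚ + 1), h2, mul_one] at this

open PowerSeries in
/-- The equation `w' * D' = 2 * D` has no solution vanishing to order two. -/
theorem X_pow_dvd_of_ode {D : ℚ⟦X⟧} (h2 : X ^ 2 ∣ D) {m : ℕ}
    (h : X ^ m ∣ d⁄dX ℚ sinhSq * d⁄dX ℚ D - 2 * D) : X ^ m ∣ D := by
  induction m with
  | zero => simp
  | succ m ih =>
    have hm := ih ((pow_dvd_pow X m.le_succ).trans h)
    rcases lt_or_ge m 2 with hlt | hge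
    · exact (pow_dvd_pow X hlt).trans h2
    · obtain ⟨G, rfl⟩ := hm
      obtain ⟨u, hu, hu2⟩ := exists_derivative_sinhSq
      obtain ⟨m, rfl⟩ : ∃ k, m = k + 1 := ⟨m - 1, by omega⟩
      have : d⁄dX ℚ sinhSq * d⁄dX ℚ (X ^ (m + 1) * G) - 2 * (X ^ (m + 1) * G) =
          X ^ (m + 1) * (u * ((m : ℚ⟦X⟧) + 1) * G + u * X * d⁄dX ℚ G - 2 * G) := by
        rw [hu, Derivation.leibniz, derivative_pow, derivative_X]
        simp only [smul_eq_mul, Nat.add_sub_cancel]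
        push_cast
        ring
      rw [this, pow_succ X (m + 1)] at h
      have h' := (mul_dvd_mul_iff_left (pow_ne_zero _ X_ne_zero)).1 h
      rw [X_dvd_iff] at h'
      rw [pow_succ X (m + 1)]
      apply mul_dvd_mul_left
      rw [X_dvd_iff]
      simp only [map_add, map_sub, map_mul, hu2, map_natCast, map_one, constantCoeff_X, mul_zero,
        zero_mul, add_zero, map_ofNat] at h'
      -- Since w' = 2t + ⋯, the operator scales the leading term of order `m + 1` by 2(m+1) - 2.
      have h3 : (2 * (m : ℚ)) * constantCoeff G = 0 := by linear_combination h'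
      rcases mul_eq_zero.1 h3 with h4 | h4
      · have : (m : ℚ) = 0 := by linarith
        have : m = 0 := by exact_mod_cast this
        omega
      · exact h4

/-- The coefficients of the expansion of `t * tanh (t / 2)` in powers of `sinhSq`. -/
def tanhCoeff (k : ℕ) : ℚ :=
  (-1) ^ k * (k.factorial * (k + 1).factorial) / ((2 * k + 2).factorial : ℚ)

/-- The relation that cancels w^(k+2) in the differential equation, given w'² = w² + 4w. -/
theorem tanhCoeff_succ (k : ℕ) :
    2 * (2 * k + 3) * tanhCoeff (k + 1) = -(k + 1) * tanhCoeff k := by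
  unfold tanhCoeff
  rw [show 2 * (k + 1) + 2 = (2 * k + 2) + 1 + 1 by ring, Nat.factorial_succ (2 * k + 2 + 1),
    Nat.factorial_succ (2 * k + 2), Nat.factorial_succ (k + 1), Nat.factorial_succ k]
  have := Nat.factorial_ne_zero (2 * k + 2)
  have : (k : ℚ) + 1 + 1 ≠ 0 := by positivity
  have : (2 : ℚ) * k + 2 + 1 ≠ 0 := by positivity
  have : (2 : ℚ) * k + 2 + 1 + 1 ≠ 0 := by positivity
  push_cast
  field_simp
  ring

open PowerSeries in
/-- Partial sums of the expansion of `t * tanh (t / 2)` in powers of `sinhSq`. -/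
noncomputable def tanhPartial (N : ℕ) : ℚ⟦X⟧ :=
  ∑ k ∈ Finset.range N, C (tanhCoeff k) * sinhSq ^ (k + 1)

-- All powers of w cancel except the top one, of order at least 2N+4 in t.
open PowerSeries in
theorem tanhPartial_ode (N : ℕ) :
    d⁄dX ℚ sinhSq * d⁄dX ℚ (tanhPartial (N + 1)) - sinhSq - 2 * tanhPartial (N + 1) =
      C ((N + 1) * tanhCoeff N) * sinhSq ^ (N + 2) := by
  have key : ∀ k : ℕ, d⁄dX ℚ sinhSq * d⁄dX ℚ (C (tanhCoeff k) * sinhSq ^ (k + 1)) =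
      C (tanhCoeff k) * ((k : ℚ⟦X⟧) + 1) * (sinhSq ^ (k + 2) + 4 * sinhSq ^ (k + 1)) := by
    intro k
    rw [Derivation.leibniz, derivative_C, derivative_pow]
    simp only [smul_eq_mul, Nat.add_sub_cancel]
    push_cast
    linear_combination C (tanhCoeff k) * ((k : ℚ⟦X⟧) + 1) * sinhSq ^ k * derivative_sinhSq_sq
  induction N with
  | zero =>
    rw [tanhPartial, Finset.sum_range_one, key]
    have : tanhCoeff 0 = 1 / 2 := by simp [tanhCoeff]
    have h2 : (C (1 / 2 : ℚ)) * 2 = 1 := by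
      rw [← map_ofNat C 2, ← map_mul]; norm_num
    rw [this]
    simp only [Nat.cast_zero, zero_add, one_mul]
    linear_combination sinhSq * h2
  | succ N ih =>
    have hs : tanhPartial (N + 1 + 1) =
        tanhPartial (N + 1) + C (tanhCoeff (N + 1)) * sinhSq ^ (N + 1 + 1) := by
      rw [tanhPartial, Finset.sum_range_succ, ← tanhPartial]
    rw [hs, map_add, mul_add, key]
    have hc := congrArg (C (R := ℚ)) (tanhCoeff_succ N)
    simp only [map_mul, map_add, map_neg, map_one, map_ofNat, map_natCast] at hc ih ⊢
    push_cast
    linear_combination ih + sinhSq ^ (N + 2) * hc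

open PowerSeries in
theorem X_pow_dvd_sinhSq_pow (k : ℕ) : (X : ℚ⟦X⟧) ^ (2 * k) ∣ sinhSq ^ k := by
  rw [pow_mul]; exact pow_dvd_pow_of_dvd X_sq_dvd_sinhSq k

open PowerSeries in
theorem X_pow_dvd_genocchiTanh_sub (N : ℕ) :
    X ^ (2 * N + 4) ∣ genocchiTanh - tanhPartial (N + 1) := by
  apply X_pow_dvd_of_ode
  · apply dvd_sub X_sq_dvd_genocchiTanh
    apply Finset.dvd_sum
    intro k _
    apply Dvd.dvd.mul_left
    exact X_sq_dvd_sinhSq.trans (dvd_pow_self _ (by omega))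
  · have : d⁄dX ℚ sinhSq * d⁄dX ℚ (genocchiTanh - tanhPartial (N + 1)) -
        2 * (genocchiTanh - tanhPartial (N + 1)) =
        -(C ((N + 1) * tanhCoeff N) * sinhSq ^ (N + 2)) := by
      rw [← tanhPartial_ode, map_sub]
      linear_combination derivative_sinhSq_mul_derivative_genocchiTanh
    rw [this, dvd_neg]
    exact (X_pow_dvd_sinhSq_pow (N + 2)).mul_left _

/-! ### Central factorial numbers and Gandhi's theorem -/

open PowerSeries in
/-- The central factorial numbers. -/
noncomputable def centralFactorial (n k : ℕ) : ℚ :=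
  ((2 * n).factorial : ℚ) / ((2 * k).factorial : ℚ) * coeff (2 * n) (sinhSq ^ k)

open PowerSeries in
theorem centralFactorial_eq_zero {n k : ℕ} (h : n < k) : centralFactorial n k = 0 := by
  rw [centralFactorial, X_pow_dvd_iff.1 (X_pow_dvd_sinhSq_pow k) _ (by omega), mul_zero]

theorem centralFactorial_zero_zero : centralFactorial 0 0 = 1 := by
  simp [centralFactorial]

open PowerSeries in
theorem centralFactorial_succ_zero (n : ℕ) : centralFactorial (n + 1) 0 = 0 := by
  simp [centralFactorial, coeff_one]

open PowerSeries in
theorem centralFactorial_succ_succ (n k : ℕ) :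
    centralFactorial (n + 1) (k + 1) =
      ((k : ℚ) + 1) ^ 2 * centralFactorial n (k + 1) + centralFactorial n k := by
  have h := congrArg (coeff (2 * n)) (derivative_derivative_sinhSq_pow k)
  have e1 : ((k : ℚ⟦X⟧) + 1) ^ 2 = C (((k : ℚ) + 1) ^ 2) := by simp
  have e2 : (2 * (k : ℚ⟦X⟧) + 2) * (2 * k + 1) = C ((2 * (k : ℚ) + 2) * (2 * k + 1)) := by
    simp only [map_mul, map_add, map_one, map_ofNat, map_natCast]
  rw [coeff_derivative, coeff_derivative, map_add, e1, e2, coeff_C_mul, coeff_C_mul] at h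
  unfold centralFactorial
  rw [show 2 * (n + 1) = 2 * n + 1 + 1 by ring, show 2 * (k + 1) = 2 * k + 1 + 1 by ring,
    Nat.factorial_succ (2 * n + 1), Nat.factorial_succ (2 * n), Nat.factorial_succ (2 * k + 1),
    Nat.factorial_succ (2 * k)]
  have := Nat.factorial_ne_zero (2 * k)
  have : (2 : ℚ) * k + 1 ≠ 0 := by positivity
  have : (2 : ℚ) * k + 1 + 1 ≠ 0 := by positivity
  push_cast at h ⊢
  field_simp
  linear_combination h

/-- Gandhi's operator. -/
def gandhiStep (r : ℕ → ℚ) (k : ℕ) : ℚ := k ^ 2 * (r (k + 1) - r k)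

/-- Summation by parts: the factor (-1)^k k!² turns the recurrence of the central factorial numbers
into minus `gandhiStep` acting on `r`. -/
theorem sum_centralFactorial (N n : ℕ) (h : n < N) (r : ℕ → ℚ) :
    ∑ k ∈ Finset.range N, (-1) ^ k * (k.factorial : ℚ) ^ 2 * r (k + 1) *
      centralFactorial (n + 1) (k + 1) = (-1) ^ n * (gandhiStep^[n] r) 1 := by
  induction n generalizing r with
  | zero =>
    rw [Finset.sum_eq_single 0]
    · simp [centralFactorial_succ_succ, centralFactorial_eq_zero, centralFactorial_zero_zero]
    · intro k _ hk
      rw [centralFactorial_eq_zero (by omega), mul_zero]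
    · simp; omega
  | succ n ih =>
    rw [Function.iterate_succ_apply, pow_succ, mul_right_comm, ← ih (by omega)]
    obtain ⟨M, rfl⟩ : ∃ M, N = M + 1 := ⟨N - 1, by omega⟩
    -- Both boundary terms of the shift vanish.
    have hshift : ∑ k ∈ Finset.range (M + 1), (-1) ^ k * (k.factorial : ℚ) ^ 2 * r (k + 1) *
        centralFactorial (n + 1) k = ∑ k ∈ Finset.range (M + 1),
          (-1) ^ (k + 1) * ((k + 1).factorial : ℚ) ^ 2 * r (k + 2) *
            centralFactorial (n + 1) (k + 1) := by
      rw [Finset.sum_range_succ', centralFactorial_succ_zero, mul_zero, add_zero,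
        Finset.sum_range_succ _ M, centralFactorial_eq_zero (show n + 1 < M + 1 by omega), mul_zero,
        add_zero]
    simp only [centralFactorial_succ_succ (n + 1), mul_add, Finset.sum_add_distrib]
    rw [hshift, ← Finset.sum_add_distrib, Finset.sum_mul]
    apply Finset.sum_congr rfl
    intro k _
    rw [gandhiStep, Nat.factorial_succ]
    push_cast
    ring

open PowerSeries in
/-- The Genocchi numbers are the values at `1` of the Gandhi polynomials. -/
theorem gandhi_eq_genocchi (n : ℕ) : (gandhiStep^[n] fun k => (k : ℚ)) 1 = genocchi (n + 1) := by
  have h1 := sum_centralFactorial (n + 1) n (by omega) fun k => (k : ℚ)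
  have h2 := X_pow_dvd_iff.1 (X_pow_dvd_genocchiTanh_sub n) (2 * (n + 1)) (by omega)
  rw [map_sub, sub_eq_zero, genocchiTanh, map_sub, coeff_X, if_neg (by omega), tanhPartial,
    map_sum, zero_sub, neg_eq_iff_eq_neg] at h2
  rw [genocchi, h2]
  have h3 : ((-1 : ℚ) ^ n) * (-1) ^ n = 1 := by rw [← mul_pow]; simp
  have h4 : (gandhiStep^[n] fun k => (k : ℚ)) 1 =
      (-1) ^ n * ((-1) ^ n * (gandhiStep^[n] fun k => (k : ℚ)) 1) := by rw [← mul_assoc, h3, one_mul]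
  rw [h4, ← h1, pow_succ, mul_neg_one, neg_mul, neg_mul_neg, mul_assoc]
  congr 1
  rw [Finset.mul_sum]
  apply Finset.sum_congr rfl
  intro k _
  -- Here (2k+2)! times `tanhCoeff k` is (-1)^k k!² (k+1), which is why `r` is the identity.
  rw [coeff_C_mul, centralFactorial, tanhCoeff, Nat.factorial_succ k,
    show 2 * (k + 1) = 2 * k + 2 by ring]
  push_cast
  ring

/-! ### Permutations as words, and avoidance as a chain condition -/

theorem ofFn_permLetter_perm_descList {m : ℕ} (σ : Equiv.Perm (Fin m)) :
    (List.ofFn (permLetter σ)).Perm (descList m) := by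
  rw [List.perm_ext_iff_of_nodup _ (nodup_descList m)]
  · intro a
    rw [List.mem_ofFn, mem_descList]
    constructor
    · rintro ⟨i, rfl⟩
      have := (σ i).isLt
      unfold permLetter
      omega
    · rintro ⟨h1, h2⟩
      refine ⟨σ.symm ⟨a - 1, by omega⟩, ?_⟩
      simp only [permLetter, Equiv.apply_symm_apply]
      omega
  · rw [List.nodup_ofFn]
    intro i j h
    apply σ.injective
    apply Fin.ext
    simpa [permLetter] using h

theorem nodup_permutations'_descList (m : ℕ) : (descList m).permutations'.Nodup :=
  (List.permutations_perm_permutations' _).nodup_iff.1 (List.nodup_permutations _ (nodup_descList m))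

open Classical in
theorem image_ofFn_permLetter (m : ℕ) :
    (Finset.univ : Finset (Equiv.Perm (Fin m))).image (fun σ => List.ofFn (permLetter σ)) =
      (descList m).permutations'.toFinset := by
  apply Finset.eq_of_subset_of_card_le
  · intro l hl
    obtain ⟨σ, -, rfl⟩ := Finset.mem_image.1 hl
    rw [List.mem_toFinset, List.mem_permutations']
    exact ofFn_permLetter_perm_descList σ
  · rw [Finset.card_image_of_injective, Finset.card_univ, Fintype.card_perm, Fintype.card_fin,
      List.toFinset_card_of_nodup (nodup_permutations'_descList m),
      ← (List.permutations_perm_permutations' _).length_eq, List.length_permutations,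
      length_descList]
    intro σ τ h
    ext i
    have := congrFun (List.ofFn_injective h) i
    simpa [permLetter] using this

open Classical in
/-- Permutations of `{1, …, m}` may be counted through their words. -/
theorem card_perm_eq_countP (m : ℕ) (P : List ℕ → Prop) :
    Nat.card {σ : Equiv.Perm (Fin m) // P (List.ofFn (permLetter σ))} =
      (descList m).permutations'.countP (fun w => P w) := by
  have h1 : (descList m).permutations'.countP (fun w => P w) =
      ((descList m).permutations'.toFinset.filter P).card := by
    rw [List.countP_eq_length_filter,
      ← List.toFinset_card_of_nodup ((nodup_permutations'_descList m).filter _)]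
    congr 1
    ext l
    simp
  rw [h1, ← image_ofFn_permLetter, Finset.filter_image, Finset.card_image_of_injective,
    Nat.card_eq_fintype_card, Fintype.card_subtype]
  intro σ τ h
  ext i
  have := congrFun (List.ofFn_injective h) i
  simpa [permLetter] using this

theorem isChain_ofFn_iff {m : ℕ} (R : ℕ → ℕ → Prop) (f : Fin m → ℕ) :
    (List.ofFn f).IsChain R ↔
      ∀ (i : ℕ) (h : i + 2 ≤ m), R (f ⟨i, by omega⟩) (f ⟨i + 1, by omega⟩) := by
  rw [List.isChain_iff_getElem]
  simp only [List.getElem_ofFn, List.length_ofFn]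
  exact ⟨fun H i h => H i (by omega), fun H i h => H i (by omega)⟩

theorem permLetter_ne {m : ℕ} (σ : Equiv.Perm (Fin m)) {i j : Fin m} (h : i ≠ j) :
    permLetter σ i ≠ permLetter σ j := by
  intro h'
  apply h
  apply σ.injective
  apply Fin.ext
  simpa [permLetter] using h'

theorem descent_occursAt_iff {m : ℕ} (x y : ParityMark) (σ : Equiv.Perm (Fin m)) (i : ℕ) :
    ParityPattern.OccursAt ⟨![2, 1], ![x, y]⟩ σ i ↔ ∃ h : i + 2 ≤ m,
      permLetter σ ⟨i + 1, by omega⟩ < permLetter σ ⟨i, by omega⟩ ∧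
      x.Allows (permLetter σ ⟨i, by omega⟩) ∧ y.Allows (permLetter σ ⟨i + 1, by omega⟩) := by
  unfold ParityPattern.OccursAt
  apply exists_congr
  intro h
  simp only [Fin.forall_fin_two, Matrix.cons_val_zero, Matrix.cons_val_one, Fin.val_zero,
    Fin.val_one, add_zero, lt_irrefl]
  constructor
  · rintro ⟨⟨-, h1⟩, h2⟩
    exact ⟨by simpa using h1, h2⟩
  · rintro ⟨h1, h2⟩
    refine ⟨⟨⟨by simp, ?_⟩, ?_⟩, h2⟩
    · simpa using h1.le
    · simpa using h1

theorem ascent_occursAt_iff {m : ℕ} (x y : ParityMark) (σ : Equiv.Perm (Fin m)) (i : ℕ) :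
    ParityPattern.OccursAt ⟨![1, 2], ![x, y]⟩ σ i ↔ ∃ h : i + 2 ≤ m,
      permLetter σ ⟨i, by omega⟩ < permLetter σ ⟨i + 1, by omega⟩ ∧
      x.Allows (permLetter σ ⟨i, by omega⟩) ∧ y.Allows (permLetter σ ⟨i + 1, by omega⟩) := by
  unfold ParityPattern.OccursAt
  apply exists_congr
  intro h
  simp only [Fin.forall_fin_two, Matrix.cons_val_zero, Matrix.cons_val_one, Fin.val_zero,
    Fin.val_one, add_zero, lt_irrefl]
  constructor
  · rintro ⟨⟨h1, -⟩, h2⟩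
    exact ⟨by simpa using h1, h2⟩
  · rintro ⟨h1, h2⟩
    refine ⟨⟨⟨by simp, ?_⟩, ?_⟩, h2⟩
    · simpa using h1
    · simpa using h1.le

/-! ### Removing the largest even letter -/

/-- An ascent, or a descent between odd letters. -/
def oddDescRel (a b : ℕ) : Prop := a < b ∨ (¬ Even a ∧ ¬ Even b)

theorem avoid_descents_iff {m : ℕ} (σ : Equiv.Perm (Fin m)) :
    pattern2s1e.AvoidedBy σ ∧ pattern2e1s.AvoidedBy σ ↔
      (List.ofFn (permLetter σ)).IsChain oddDescRel := by
  rw [isChain_ofFn_iff]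
  simp only [ParityPattern.AvoidedBy, pattern2s1e, pattern2e1s, descent_occursAt_iff,
    ParityMark.Allows, ← forall_and]
  apply forall_congr'
  intro i
  by_cases h : i + 2 ≤ m
  · have := permLetter_ne σ (i := ⟨i, by omega⟩) (j := ⟨i + 1, by omega⟩) (by simp)
    simp only [h, exists_true_left, forall_true_left, oddDescRel, true_and, and_true]
    rcases lt_or_gt_of_ne this with h1 | h1
    · simp [h1, h1.not_gt]
    · simp [h1, h1.not_gt, -Nat.not_even_iff_odd, and_comm]
  · simp [h]

theorem avoid_alternating_iff {m : ℕ} (σ : Equiv.Perm (Fin m)) :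
    pattern1e2s.AvoidedBy σ ∧ pattern2o1s.AvoidedBy σ ↔
      (List.ofFn (permLetter σ)).IsChain altRel := by
  rw [isChain_ofFn_iff]
  simp only [ParityPattern.AvoidedBy, pattern1e2s, pattern2o1s, descent_occursAt_iff,
    ascent_occursAt_iff, ParityMark.Allows, ← forall_and]
  apply forall_congr'
  intro i
  by_cases h : i + 2 ≤ m
  · have := permLetter_ne σ (i := ⟨i, by omega⟩) (j := ⟨i + 1, by omega⟩) (by simp)
    simp only [h, exists_true_left, forall_true_left, altRel, and_true, ← Nat.not_even_iff_odd]
    rcases lt_or_gt_of_ne this with h1 | h1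
    · by_cases h2 : Even (permLetter σ ⟨i, by omega⟩) <;>
        simp [h1, h1.not_gt, h2, -Nat.not_even_iff_odd]
    · by_cases h2 : Even (permLetter σ ⟨i, by omega⟩) <;>
        simp [h1, h1.not_gt, h2, -Nat.not_even_iff_odd]
  · simp [h]

-- Anywhere but at the end, `v` would start a forbidden descent. The fixed head `a` makes the
-- induction run.
open Classical in
theorem countP_insert_tail {v : ℕ} (hv : Even v) (a : ℕ) (t : List ℕ)
    (hlt : ∀ b ∈ a :: t, b < v) :
    (t.permutations'Aux v).countP (fun u => (a :: u).IsChain oddDescRel) =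
      if (a :: t).IsChain oddDescRel then 1 else 0 := by
  induction t generalizing a with
  | nil => simp [oddDescRel, hlt a (by simp)]
  | cons b t ih =>
    have hb := hlt b (by simp)
    have hvb : ¬ oddDescRel v b := fun h => h.elim hb.not_gt fun h => h.1 hv
    rw [List.permutations'Aux, List.countP_cons, List.countP_map]
    simp only [Function.comp_def, List.isChain_cons_cons, hvb, false_and, and_false, decide_false,
      Bool.false_eq_true, if_false, add_zero]
    by_cases h : oddDescRel a b
    · simp only [h, true_and]
      exact ih b fun c hc => hlt c (List.mem_cons_of_mem _ hc)
    · simp [h]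

open Classical in
/-- An even letter exceeding all others can only be inserted at the end. -/
theorem countP_insert {v : ℕ} (hv : Even v) (w : List ℕ) (hlt : ∀ b ∈ w, b < v) :
    (w.permutations'Aux v).countP (fun u => u.IsChain oddDescRel) =
      if w.IsChain oddDescRel then 1 else 0 := by
  cases w with
  | nil => simp
  | cons b t =>
    have hb := hlt b (by simp)
    have hvb : ¬ oddDescRel v b := fun h => h.elim hb.not_gt fun h => h.1 hv
    rw [List.permutations'Aux, List.countP_cons, List.countP_map]
    simp only [Function.comp_def, List.isChain_cons_cons, hvb, false_and, decide_false,
      Bool.false_eq_true, if_false, add_zero]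
    exact countP_insert_tail hv b t hlt

theorem avoidCount_descents {m : ℕ} (hm : Even (m + 1)) :
    avoidCount (m + 1) pattern2s1e pattern2e1s = avoidCount m pattern2s1e pattern2e1s := by
  classical
  unfold avoidCount
  simp only [avoid_descents_iff]
  rw [card_perm_eq_countP _ (fun w => w.IsChain oddDescRel),
    card_perm_eq_countP _ (fun w => w.IsChain oddDescRel), descList, List.permutations',
    List.countP_flatMap]
  have hsum : ∀ l : List (List ℕ), (l.map fun w => if w.IsChain oddDescRel then 1 else 0).sum =
      l.countP fun w => w.IsChain oddDescRel := by
    intro l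
    induction l with
    | nil => rfl
    | cons w l ih => rw [List.map_cons, List.sum_cons, ih, List.countP_cons, add_comm]; simp
  refine Eq.trans (congrArg List.sum (List.map_congr_left ?_)) ((hsum _).trans (by congr!))
  intro w hw
  rw [List.mem_permutations'] at hw
  have hlt : ∀ b ∈ w, b < m + 1 := fun b hb => by
    have := mem_descList.1 (hw.mem_iff.1 hb)
    omega
  rw [← countP_insert hm w hlt, Function.comp_apply]
  congr!

/-! ### Complementation and conclusion -/

theorem isDumont_iff (w : List ℕ) :
    IsDumont w ↔ w.IsChain altRel ∧ ∃ h : w ≠ [], ¬ Even (w.getLast h) := by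
  induction w with
  | nil => simp [IsDumont]
  | cons a t ih =>
    cases t with
    | nil => simp [IsDumont]
    | cons b t =>
      rw [IsDumont, ih, List.isChain_cons_cons, and_assoc]
      simp

theorem isDumont_ofFn_iff {m : ℕ} (σ : Equiv.Perm (Fin (m + 1))) :
    IsDumont (List.ofFn (permLetter σ)) ↔
      (List.ofFn (permLetter σ)).IsChain altRel ∧ ¬ Even (permLetter σ (Fin.last m)) := by
  rw [isDumont_iff]
  apply and_congr_right
  intro _
  have : List.ofFn (permLetter σ) ≠ [] := by simp
  rw [exists_prop_of_true this, List.getLast_ofFn]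
  rfl

theorem permLetter_trans_rev {m : ℕ} (σ : Equiv.Perm (Fin m)) (i : Fin m) :
    permLetter (σ.trans Fin.revPerm) i + permLetter σ i = m + 1 := by
  have := (σ i).isLt
  simp only [permLetter, Equiv.trans_apply, Fin.revPerm_apply, Fin.val_rev]
  omega

/-- As m+1 is odd, the complement reverses both order and parity, which exchanges the two cases of
`altRel`. -/
theorem isChain_trans_rev {m : ℕ} (hm : Even m) (σ : Equiv.Perm (Fin m))
    (h : (List.ofFn (permLetter σ)).IsChain altRel) :
    (List.ofFn (permLetter (σ.trans Fin.revPerm))).IsChain altRel := by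
  rw [isChain_ofFn_iff] at h ⊢
  intro i hi
  have h0 := h i hi
  have h1 := permLetter_trans_rev σ ⟨i, by omega⟩
  have h2 := permLetter_trans_rev σ ⟨i + 1, by omega⟩
  unfold altRel at h0 ⊢
  simp only [Nat.even_iff] at hm h0 ⊢
  split_ifs at h0 ⊢ <;> omega

open Classical in
theorem avoidCount_alternating {m : ℕ} (hm : Even (m + 1)) :
    avoidCount (m + 1) pattern1e2s pattern2o1s =
      2 * (descList (m + 1)).permutations'.countP (fun w => IsDumont w) := by
  rw [← card_perm_eq_countP, avoidCount]
  simp only [avoid_alternating_iff, isDumont_ofFn_iff]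
  rw [Nat.card_eq_fintype_card, Nat.card_eq_fintype_card, Fintype.card_subtype,
    Fintype.card_subtype, ← Finset.card_filter_add_card_filter_not
      (fun σ => ¬ Even (permLetter σ (Fin.last m))), Finset.filter_filter, Finset.filter_filter,
    two_mul]
  congr 1
  have hinv : ∀ σ : Equiv.Perm (Fin (m + 1)),
      (σ.trans Fin.revPerm).trans Fin.revPerm = σ := fun σ => by ext i; simp
  have hpar : ∀ σ : Equiv.Perm (Fin (m + 1)), Even (permLetter (σ.trans Fin.revPerm) (Fin.last m)) ↔
      ¬ Even (permLetter σ (Fin.last m)) := fun σ => by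
    have := permLetter_trans_rev σ (Fin.last m)
    rw [Nat.even_iff] at hm ⊢
    rw [Nat.even_iff]
    omega
  refine Finset.card_nbij' (fun σ => σ.trans Fin.revPerm) (fun σ => σ.trans Fin.revPerm)
    ?_ ?_ (fun σ _ => hinv σ) (fun σ _ => hinv σ)
  · intro σ h
    simp only [Finset.coe_filter, Finset.mem_univ, true_and, Set.mem_ofPred_eq] at h ⊢
    exact ⟨isChain_trans_rev hm σ h.1, by rw [hpar]; exact h.2⟩
  · intro σ h
    simp only [Finset.coe_filter, Finset.mem_univ, true_and, Set.mem_ofPred_eq] at h ⊢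
    exact ⟨isChain_trans_rev hm σ h.1, by rw [hpar, not_not]; exact h.2⟩

theorem altSum_eq_gandhi (n : ℕ) (k : ℕ) :
    altSum (2 * n + 1) k = (gandhiStep^[n] fun k => (k : ℚ)) k := by
  induction n generalizing k with
  | zero => exact altSum_one k
  | succ n ih =>
    rw [Function.iterate_succ_apply', gandhiStep, ← ih, ← ih,
      show 2 * (n + 1) + 1 = 2 * n + 3 by ring, altSum_odd, altSum_even]
    push_cast
    ring

/-- Dumont's theorem. -/
theorem altSum_one_eq_genocchi (n : ℕ) : altSum (2 * n + 2) 1 = genocchi (n + 2) := by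
  -- At x = 1 inserting the odd letter 2n+3 multiplies by 1, which moves the value to an odd index,
  -- where Gandhi's iterates apply.
  rw [← gandhi_eq_genocchi, ← altSum_eq_gandhi, show 2 * (n + 1) + 1 = 2 * n + 3 by ring,
    Nat.cast_one, altSum_odd, one_mul]

theorem mainTheorem11 :
    -- first part, for each `n` conditional on the conjectured count in `S_{2n}`
    (∀ n : ℕ, 1 ≤ n →
      (avoidCount (2 * n) pattern2s1e pattern2e1s : ℚ) = genocchi (n + 1) →
        (avoidCount (2 * n - 1) pattern2s1e pattern2e1s : ℚ) = genocchi (n + 1)) ∧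
    -- second part, unconditional
    (∀ n : ℕ, 1 ≤ n →
      (avoidCount (2 * n) pattern1e2s pattern2o1s : ℚ) = 2 * genocchi (n + 1)) := by
  classical
  constructor
  · intro n hn h
    obtain ⟨n, rfl⟩ : ∃ k, n = k + 1 := ⟨n - 1, by omega⟩
    rw [show 2 * (n + 1) = 2 * n + 1 + 1 by ring] at h ⊢
    rw [Nat.add_sub_cancel, ← h, avoidCount_descents (m := 2 * n + 1) (by rw [Nat.even_iff]; omega)]
  · intro n hn
    obtain ⟨n, rfl⟩ : ∃ k, n = k + 1 := ⟨n - 1, by omega⟩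
    rw [show 2 * (n + 1) = 2 * n + 1 + 1 by ring,
      avoidCount_alternating (by rw [Nat.even_iff]; omega), Nat.cast_mul, ← altSum_eq_countP,
      altSum_one_eq_genocchi, Nat.cast_ofNat]
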